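/- **The chain.** Let $N\ge 2$, $l_0>0$ and $0<\bar\theta<\pi$. Consider a planar serial chain of closed disks $L_0$ (the root link), $L_1,\dots,L_N$ (the sublinks) with radii $\delta_0,\dots,\delta_N>0$. The centers of consecutive disks are joined by line segments of equal length $l_0$, with $l_0>\delta_i+\delta_{i+1}$ for $0\le i<N$, and the $N$ revolute joints have equal limits $\theta_i\in[-\bar\theta,\bar\theta]$. If the root has center $p$ and heading $v\ne 0$, the sublinks trail behind it: the segment from $L_0$ to $L_1$ has the direction of $-v$ rotated by $\theta_1$, and for $i\ge 2$ the segment from $L_{i-1}$ to $L_i$ has the direction of the preceding segment rotated by $\theta_i$. The volume of the chain is the union of the $N+1$ disks and the $N$ connecting segments. **Path space.** Put $$\kappa_N=\frac{2\sin\bar\theta}{N l_0},\qquad R_0=\frac1{\kappa_N},\qquad d_{\kappa_N}=R_0-\sqrt{R_0^2-\tfrac{l_0^2}{4}}.$$ For a point $p$ and a direction vector $v$, let $P_N(p,v)$ be the union, over all joint configurations within the limits, of the $N$ segments of the chain that issues from $p$ in direction $v$ (so that its first segment has the direction of $v$ rotated by $\theta_1$). Let $\mathcal F_{\kappa_N}$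 be the set of regular $C^2$ paths $\tau:[0,1]\to\mathbb R^2$ (that is, $\tau'\neq 0$ everywhere) with $\tau(1)\notin P_N(\tau(0),\tau'(0))$ and curvature at most $\kappa_N$ everywhere. **Extended path.** Let $\tau_{\kappa_N},\tau_I:[0,1]\to\mathbb R^2$ be paths with $\tau_I(1)=\tau_{\kappa_N}(0)$, and let $\tau$ be their concatenation, first $\tau_I$ on $[0,b]$ and then $\tau_{\kappa_N}$ on $[b,1]$, each reparametrized affinely, for some $b\in(0,1)$. Assume that $\tau\in\mathcal F_{\kappa_N}$. Assume also that there is a start configuration of the chain within the joint limits, with root at $\tau_{\kappa_N}(0)$ and heading $\tau_{\kappa_N}'(0)$, such that $\tau_I$ starts at time $0$ at the center of $L_N$ and then passes in order through the centers of $L_{N-1},\dots,L_1$ until it reaches the center of $L_0$ at time $1$. **Theorem.** Suppose that $\delta_i\le\delta_0$ for all $i$ and $d_{\kappa_N}\le\delta_0$. Then for every $s\in[0,1]$ there is a joint configuration $\theta_1(s),\dots,\theta_N(s)\in[-\bar\theta,\bar\theta]$ such that the volume of the chain with root at $\tau_{\kappa_N}(s)$, heading $\tau_{\kappa_N}'(s)$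 and this configuration is contained in the swept volume $$\tau\oplus L_0=\{\tau(t)+x:\ t\in[0,1],\ \|x\|\le\delta_0\}.$$ -/

import Mathlib

open scoped Pointwise

noncomputable section

/-! Planar serial chains of disks. The Euclidean plane `ℝ²` is modelled by `ℂ` with its usual
(Euclidean) norm; rotation by the angle `t` is multiplication by `exp (t * I)`. Joint angles
`θ 0, …, θ (N - 1)` and radii `δ 0, …, δ N` are sequences, of which only these entries matter. -/
namespace SerialChain

/-- Center of the link `L_i` of a chain with link length `l`, whose root is centered at `p`, whose
rest direction (all joint angles zero) is that of the nonzero vector `w`, and whose joint angles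
are `θ`: the line from `L_j` to `L_{j+1}` is obtained from the preceding one (for `j = 0` from the
direction `w`) by the rotation `θ j`. -/
def linkCenter (l : ℝ) (p w : ℂ) (θ : ℕ → ℝ) (i : ℕ) : ℂ :=
  p + (l : ℂ) * (w / (‖w‖ : ℂ)) *
    ∑ j ∈ Finset.range i, Complex.exp (((∑ k ∈ Finset.range (j + 1), θ k : ℝ) : ℂ) * Complex.I)

/-- All `N` joint angles lie in `[-θbar, θbar]`. -/
def WithinJointLimits (N : ℕ) (θbar : ℝ) (θ : ℕ → ℝ) : Prop :=
  ∀ i < N, θ i ∈ Set.Icc (-θbar) θbar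

/-- The `N` line segments that connect the centers of consecutive links. -/
def chainLines (N : ℕ) (l : ℝ) (p w : ℂ) (θ : ℕ → ℝ) : Set ℂ :=
  ⋃ i < N, segment ℝ (linkCenter l p w θ i) (linkCenter l p w θ (i + 1))

/-- The volume of the chain: the `N + 1` closed disks together with the connecting lines. -/
def chainVolume (N : ℕ) (l : ℝ) (δ : ℕ → ℝ) (p w : ℂ) (θ : ℕ → ℝ) : Set ℂ :=
  (⋃ i ≤ N, Metric.closedBall (linkCenter l p w θ i) (δ i)) ∪ chainLines N l p w θ

/-- The region `P_N`: the points covered by the lines of the chain issuing from `p` in the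
direction `w`, over all joint configurations within the limits. -/
def reachRegion (N : ℕ) (l θbar : ℝ) (p w : ℂ) : Set ℂ :=
  {x | ∃ θ : ℕ → ℝ, WithinJointLimits N θbar θ ∧ x ∈ chainLines N l p w θ}

/-- First derivative of a path parametrized by `[0, 1]` (one-sided at the end points). -/
def velocity (τ : ℝ → ℂ) (s : ℝ) : ℂ :=
  derivWithin τ (Set.Icc 0 1) s

/-- Second derivative of a path parametrized by `[0, 1]` (one-sided at the end points). -/
def acceleration (τ : ℝ → ℂ) (s : ℝ) : ℂ :=
  derivWithin (velocity τ) (Set.Icc 0 1) s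

/-- Curvature `|det (τ', τ'')| / ‖τ'‖ ^ 3` of a regular planar path. -/
def curvature (τ : ℝ → ℂ) (s : ℝ) : ℝ :=
  |(velocity τ s).re * (acceleration τ s).im - (velocity τ s).im * (acceleration τ s).re| /
    ‖velocity τ s‖ ^ 3

/-- The curvature bound `κ_N = 2 sin θbar / (N l)`. -/
def maxCurvature (N : ℕ) (l θbar : ℝ) : ℝ :=
  2 * Real.sin θbar / (N * l)

/-- The radius `R_0 = N l / (2 sin θbar)` of the circle of curvature `κ_N`. -/
def minRadius (N : ℕ) (l θbar : ℝ) : ℝ :=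
  N * l / (2 * Real.sin θbar)

/-- The distance `d_{κ_N} = R_0 - √(R_0² - l² / 4)`. -/
def maxDeviation (N : ℕ) (l θbar : ℝ) : ℝ :=
  minRadius N l θbar - Real.sqrt (minRadius N l θbar ^ 2 - l ^ 2 / 4)

/-- The path space `F_{κ_N}` for the initial data `(p, v)`: regular `C²` paths on `[0, 1]` that
start at `p` with velocity `v`, end outside of `P_N`, and have curvature at most `κ_N`. -/
def pathSpace (N : ℕ) (l θbar : ℝ) (p v : ℂ) : Set (ℝ → ℂ) :=
  {τ | ContDiffOn ℝ 2 τ (Set.Icc 0 1) ∧ (∀ s ∈ Set.Icc (0 : ℝ) 1, velocity τ s ≠ 0) ∧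
    τ 0 = p ∧ velocity τ 0 = v ∧ τ 1 ∉ reachRegion N l θbar p v ∧
    ∀ s ∈ Set.Icc (0 : ℝ) 1, curvature τ s ≤ maxCurvature N l θbar}

/-- Concatenation on `[0, 1]`: first `τI`, run on `[0, b]`, and then `τκ`, run on `[b, 1]`. -/
def concatPath (b : ℝ) (τI τκ : ℝ → ℂ) (t : ℝ) : ℂ :=
  if t ≤ b then τI (t / b) else τκ ((t - b) / (1 - b))

/-- The path `τI` starts at time `0` at the center of `L_N`, and then visits the centers of
`L_{N-1}, …, L_1` in this order, until it reaches the center of `L_0` at time `1`, where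
`c 0, …, c N` are the centers of the links. -/
def VisitsLinks (N : ℕ) (c : ℕ → ℂ) (τI : ℝ → ℂ) : Prop :=
  ∃ u : ℕ → ℝ, u 0 = 1 ∧ u N = 0 ∧ (∀ i < N, u (i + 1) ≤ u i) ∧ ∀ i ≤ N, τI (u i) = c i

end SerialChain

end

/-! Follow the path backwards from the root and place each link where the path first leaves the disk
of radius `l` about the preceding center. All centers then lie on the path. What remains is that
these exits exist, that the joint angles are admissible, and that the connecting segments stay
within `δ 0` of the path.

Everything rests on `l ≤ R`, with `R` the minimal radius, and on comparison with circles of radius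
`R`. An arc that stays within distance `R` of its start has pairwise acute tangents, its two ends
possibly excepted (`acuteTangents`), and avoids the circles touching it at either end
(`abs_im_le_left`, `abs_im_le_right`). Hence a chord of length `l` makes an angle of at most `arcsin
(l / (2R))` with the tangent at each end. A joint angle is at most twice this, which is `2 arcsin
(sin θbar / N) ≤ θbar`. The chord is within the sagitta `R - √(R² - l²/4) ≤ δ 0` of the arc.

The exits exist by comparison with the start configuration, a polygon with the same edge length
inscribed in the path: each new vertex is reached, in reversed time, no later than the corresponding
old one (`exists_isFirstExit`). -/

namespace SerialChain

open Set

/-! ### Curves of bounded curvature and their symmetries -/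

/-- A regular planar curve `γ` on `[a, b]` with unit tangent `T`, speed `ρ` and signed curvature
`k`, whose curvature is at most `1 / R`. -/
structure TangentFrame (R a b : ℝ) (γ T : ℝ → ℂ) (ρ k : ℝ → ℝ) : Prop where
  radius_pos : 0 < R
  hasDeriv : ∀ t ∈ Icc a b, HasDerivWithinAt γ (ρ t * T t) (Icc a b) t
  hasDeriv_tangent :
    ∀ t ∈ Icc a b, HasDerivWithinAt T (k t * ρ t * Complex.I * T t) (Icc a b) t
  norm_tangent : ∀ t ∈ Icc a b, ‖T t‖ = 1
  speed_pos : ∀ t ∈ Icc a b, 0 < ρ t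
  curvature_le : ∀ t ∈ Icc a b, R * |k t| ≤ 1

theorem le_of_hasDerivAt_nonneg {f f' : ℝ → ℝ} {a b : ℝ} (hab : a ≤ b)
    (hc : ContinuousOn f (Icc a b)) (hd : ∀ t ∈ Ioo a b, HasDerivAt f (f' t) t)
    (h : ∀ t ∈ Ioo a b, 0 ≤ f' t) : f a ≤ f b := by
  refine monotoneOn_of_deriv_nonneg (convex_Icc a b) hc ?_ ?_ (left_mem_Icc.2 hab)
    (right_mem_Icc.2 hab) hab
  · rw [interior_Icc]
    exact fun t ht => (hd t ht).differentiableAt.differentiableWithinAt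
  · rw [interior_Icc]
    intro t ht
    rw [(hd t ht).deriv]
    exact h t ht

theorem lt_of_hasDerivAt_pos {f f' : ℝ → ℝ} {a b : ℝ} (hab : a < b)
    (hc : ContinuousOn f (Icc a b)) (hd : ∀ t ∈ Ioo a b, HasDerivAt f (f' t) t)
    (h : ∀ t ∈ Ioo a b, 0 < f' t) : f a < f b := by
  refine strictMonoOn_of_deriv_pos (convex_Icc a b) hc ?_ (left_mem_Icc.2 hab.le)
    (right_mem_Icc.2 hab.le) hab
  rw [interior_Icc]
  intro t ht
  rw [(hd t ht).deriv]
  exact h t ht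

namespace TangentFrame

variable {R a b : ℝ} {γ T : ℝ → ℂ} {ρ k : ℝ → ℝ}

theorem mono (h : TangentFrame R a b γ T ρ k) {c d : ℝ} (hc : a ≤ c) (hd : d ≤ b) :
    TangentFrame R c d γ T ρ k where
  radius_pos := h.radius_pos
  hasDeriv t ht := (h.hasDeriv t (Icc_subset_Icc hc hd ht)).mono (Icc_subset_Icc hc hd)
  hasDeriv_tangent t ht :=
    (h.hasDeriv_tangent t (Icc_subset_Icc hc hd ht)).mono (Icc_subset_Icc hc hd)
  norm_tangent t ht := h.norm_tangent t (Icc_subset_Icc hc hd ht)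
  speed_pos t ht := h.speed_pos t (Icc_subset_Icc hc hd ht)
  curvature_le t ht := h.curvature_le t (Icc_subset_Icc hc hd ht)

theorem rotate (h : TangentFrame R a b γ T ρ k) {u : ℂ} (hu : ‖u‖ = 1) (c : ℂ) :
    TangentFrame R a b (fun t => u * (γ t - c)) (fun t => u * T t) ρ k where
  radius_pos := h.radius_pos
  hasDeriv t ht := (((h.hasDeriv t ht).sub_const c).const_mul u).congr_deriv (by ring)
  hasDeriv_tangent t ht := ((h.hasDeriv_tangent t ht).const_mul u).congr_deriv (by ring)
  norm_tangent t ht := by rw [norm_mul, hu, h.norm_tangent t ht, one_mul]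
  speed_pos := h.speed_pos
  curvature_le := h.curvature_le

/-- Bounds on absolute values follow from one-sided bounds applied to a curve and its mirror image.
-/
theorem conj (h : TangentFrame R a b γ T ρ k) :
    TangentFrame R a b (fun t => (starRingEnd ℂ) (γ t)) (fun t => (starRingEnd ℂ) (T t)) ρ
      (fun t => -k t) where
  radius_pos := h.radius_pos
  hasDeriv t ht := by
    refine (Complex.conjCLE.hasFDerivAt.comp_hasDerivWithinAt t (h.hasDeriv t ht)).congr_deriv ?_
    simp
  hasDeriv_tangent t ht := by
    refine (Complex.conjCLE.hasFDerivAt.comp_hasDerivWithinAt t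
      (h.hasDeriv_tangent t ht)).congr_deriv ?_
    simp
  norm_tangent t ht := by simpa using h.norm_tangent t ht
  speed_pos := h.speed_pos
  curvature_le t ht := by simpa using h.curvature_le t ht

/-- Carries estimates at the start of an arc over to its end. The chain trails behind its root, so
the main argument also runs on the reversed path. -/
theorem reverse (h : TangentFrame R a b γ T ρ k) :
    TangentFrame R (-b) (-a) (fun t => γ (-t)) (fun t => -T (-t)) (fun t => ρ (-t))
      (fun t => -k (-t)) := by
  have hm : MapsTo (fun t : ℝ => -t) (Icc (-b) (-a)) (Icc a b) :=
    fun t ht => ⟨by linarith [ht.2], by linarith [ht.1]⟩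
  have hn : ∀ t, HasDerivWithinAt (fun t : ℝ => -t) (-1) (Icc (-b) (-a)) t :=
    fun t => (hasDerivAt_neg t).hasDerivWithinAt
  refine ⟨h.radius_pos, fun t ht => ?_, fun t ht => ?_, fun t ht => ?_,
    fun t ht => h.speed_pos _ (hm ht), fun t ht => ?_⟩
  · refine ((h.hasDeriv _ (hm ht)).scomp t (hn t) hm).congr_deriv ?_
    simp
  · refine ((h.hasDeriv_tangent _ (hm ht)).scomp t (hn t) hm).neg.congr_deriv ?_
    simp
  · simpa using h.norm_tangent _ (hm ht)
  · simpa using h.curvature_le _ (hm ht)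

theorem continuousOn (h : TangentFrame R a b γ T ρ k) : ContinuousOn γ (Icc a b) :=
  fun t ht => (h.hasDeriv t ht).continuousWithinAt

theorem continuousOn_tangent (h : TangentFrame R a b γ T ρ k) : ContinuousOn T (Icc a b) :=
  fun t ht => (h.hasDeriv_tangent t ht).continuousWithinAt

theorem hasDerivAt (h : TangentFrame R a b γ T ρ k) {t : ℝ} (ht : t ∈ Ioo a b) :
    HasDerivAt γ (ρ t * T t) t :=
  (h.hasDeriv t (Ioo_subset_Icc_self ht)).hasDerivAt (Icc_mem_nhds ht.1 ht.2)

theorem hasDerivAt_tangent (h : TangentFrame R a b γ T ρ k) {t : ℝ} (ht : t ∈ Ioo a b) :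
    HasDerivAt T (k t * ρ t * Complex.I * T t) t :=
  (h.hasDeriv_tangent t (Ioo_subset_Icc_self ht)).hasDerivAt (Icc_mem_nhds ht.1 ht.2)

theorem hasDerivAt_re (h : TangentFrame R a b γ T ρ k) {t : ℝ} (ht : t ∈ Ioo a b) :
    HasDerivAt (fun t => (γ t).re) (ρ t * (T t).re) t := by
  refine (Complex.reCLM.hasFDerivAt.comp_hasDerivAt t (h.hasDerivAt ht)).congr_deriv ?_
  simp

theorem hasDerivAt_im (h : TangentFrame R a b γ T ρ k) {t : ℝ} (ht : t ∈ Ioo a b) :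
    HasDerivAt (fun t => (γ t).im) (ρ t * (T t).im) t := by
  refine (Complex.imCLM.hasFDerivAt.comp_hasDerivAt t (h.hasDerivAt ht)).congr_deriv ?_
  simp

theorem hasDerivAt_tangent_im (h : TangentFrame R a b γ T ρ k) {t : ℝ} (ht : t ∈ Ioo a b) :
    HasDerivAt (fun t => (T t).im) (k t * ρ t * (T t).re) t := by
  refine (Complex.imCLM.hasFDerivAt.comp_hasDerivAt t (h.hasDerivAt_tangent ht)).congr_deriv ?_
  simp

theorem tangent_sq (h : TangentFrame R a b γ T ρ k) {t : ℝ} (ht : t ∈ Icc a b) :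
    (T t).re ^ 2 + (T t).im ^ 2 = 1 := by
  have := Complex.sq_norm (T t)
  rw [h.norm_tangent t ht, Complex.normSq_apply] at this
  linarith

theorem continuousOn_re (h : TangentFrame R a b γ T ρ k) :
    ContinuousOn (fun t => (γ t).re) (Icc a b) :=
  Complex.continuous_re.comp_continuousOn h.continuousOn

theorem continuousOn_im (h : TangentFrame R a b γ T ρ k) :
    ContinuousOn (fun t => (γ t).im) (Icc a b) :=
  Complex.continuous_im.comp_continuousOn h.continuousOn

/-! ### Comparison with circles of radius `R` -/

theorem re_lt_re (h : TangentFrame R a b γ T ρ k) (hab : a < b)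
    (hpos : ∀ t ∈ Ioo a b, 0 < (T t).re) : (γ a).re < (γ b).re :=
  lt_of_hasDerivAt_pos hab h.continuousOn_re (fun _ ht => h.hasDerivAt_re ht)
    fun t ht => mul_pos (h.speed_pos t (Ioo_subset_Icc_self ht)) (hpos t ht)

/-- The function `γ.re - R * T.im` has derivative `ρ * T.re * (1 - R * k) ≥ 0`. -/
theorem im_tangent_sub_le (h : TangentFrame R a b γ T ρ k) (hab : a ≤ b)
    (hpos : ∀ t ∈ Ioo a b, 0 ≤ (T t).re) :
    R * ((T b).im - (T a).im) ≤ (γ b).re - (γ a).re := by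
  have key := le_of_hasDerivAt_nonneg (f := fun t => (γ t).re - R * (T t).im) hab
    (h.continuousOn_re.sub
      ((Complex.continuous_im.comp_continuousOn h.continuousOn_tangent).const_smul R))
    (fun t ht => (h.hasDerivAt_re ht).sub ((h.hasDerivAt_tangent_im ht).const_mul R)) ?_
  · linarith
  · intro t ht
    have ht' := Ioo_subset_Icc_self ht
    have h1 : R * k t ≤ 1 :=
      (mul_le_mul_of_nonneg_left (le_abs_self _) h.radius_pos.le).trans (h.curvature_le t ht')
    have h2 := mul_nonneg (h.speed_pos t ht').le (hpos t ht)
    nlinarith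

theorem abs_im_tangent_sub_le (h : TangentFrame R a b γ T ρ k) (hab : a ≤ b)
    (hpos : ∀ t ∈ Ioo a b, 0 ≤ (T t).re) :
    R * |(T b).im - (T a).im| ≤ (γ b).re - (γ a).re := by
  rcases abs_cases ((T b).im - (T a).im) with ⟨e, -⟩ | ⟨e, -⟩ <;> rw [e]
  · exact h.im_tangent_sub_le hab hpos
  · have := h.conj.im_tangent_sub_le hab (by simpa using hpos)
    simp only [Complex.conj_im, Complex.conj_re] at this
    linarith

/-- A curve of curvature at most `1 / R` that starts along the real axis stays below the circle
of radius `R` touching the axis from above. -/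
theorem im_sub_le_of_tangent_eq_one (h : TangentFrame R a b γ T ρ k) (hab : a ≤ b)
    (hT : T a = 1) (hpos : ∀ t ∈ Ioo a b, 0 < (T t).re) (hR : (γ b).re - (γ a).re ≤ R) :
    (γ b).im - (γ a).im ≤ R - √(R ^ 2 - ((γ b).re - (γ a).re) ^ 2) := by
  have hRp := h.radius_pos
  have hx : ∀ t ∈ Ioo a b, 0 < (γ t).re - (γ a).re ∧ (γ t).re - (γ a).re < R := by
    intro t ht
    have h1 := (h.mono le_rfl ht.2.le).re_lt_re ht.1 fun r hr => hpos r ⟨hr.1, hr.2.trans ht.2⟩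
    have h2 := (h.mono ht.1.le le_rfl).re_lt_re ht.2 fun r hr => hpos r ⟨ht.1.trans hr.1, hr.2⟩
    constructor <;> linarith
  have hq : ∀ t ∈ Ioo a b, 0 < R ^ 2 - ((γ t).re - (γ a).re) ^ 2 := by
    intro t ht
    nlinarith [hx t ht]
  -- The gap between circle and curve at equal abscissa increases. The abscissa may reach `R` at
  -- `b`, where the root is not differentiable, but there continuity suffices.
  have key := le_of_hasDerivAt_nonneg
    (f := fun t => R - √(R ^ 2 - ((γ t).re - (γ a).re) ^ 2) - (γ t).im) hab ?_
    (fun t ht => ((((((h.hasDerivAt_re ht).sub_const (γ a).re).pow 2).const_sub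
      (R ^ 2)).sqrt (hq t ht).ne').const_sub R).sub (h.hasDerivAt_im ht)) ?_
  · have e : √(R ^ 2 - ((γ a).re - (γ a).re) ^ 2) = R := by
      rw [sub_self, zero_pow two_ne_zero, sub_zero, Real.sqrt_sq hRp.le]
    rw [e] at key
    linarith
  · have := h.continuousOn_re
    have := h.continuousOn_im
    fun_prop
  · intro t ht
    have ht' := Ioo_subset_Icc_self ht
    obtain ⟨hx0, hxR⟩ := hx t ht
    set x := (γ t).re - (γ a).re with hxdef
    set S := √(R ^ 2 - x ^ 2) with hS
    have hS0 : 0 < S := Real.sqrt_pos.2 (hq t ht)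
    have hS2 : S ^ 2 = R ^ 2 - x ^ 2 := Real.sq_sqrt (hq t ht).le
    have hm := (h.mono le_rfl ht.2.le).im_tangent_sub_le ht.1.le
      fun r hr => (hpos r ⟨hr.1, hr.2.trans ht.2⟩).le
    rw [hT, Complex.one_im, sub_zero] at hm
    have hsq := h.tangent_sq ht'
    have hc := hpos t ht
    -- The slope is at most the slope `x / S` of the circle: with `m = T.im` and `c = T.re`, `R m ≤
    -- x` and `m² + c² = 1` give `m² (R² - x²) ≤ x² c²`.
    have hmS : (T t).im * S ≤ x * (T t).re := by
      rcases le_or_gt (T t).im 0 with hm0 | hm0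
      · nlinarith [mul_pos hx0 hc]
      · refine (sq_le_sq₀ (by positivity) (by positivity)).1 ?_
        have : (R * (T t).im) ^ 2 ≤ x ^ 2 := by gcongr
        rw [mul_pow, mul_pow, hS2]
        nlinarith
    have hle : (T t).im ≤ x * (T t).re / S := (le_div_iff₀ hS0).2 hmS
    have hρ := h.speed_pos t ht'
    have e : -(-(((2 : ℕ) : ℝ) * x ^ (2 - 1) * (ρ t * (T t).re)) / (2 * S)) - ρ t * (T t).im
        = ρ t * (x * (T t).re / S - (T t).im) := by
      field_simp
      norm_num
      ring
    exact (mul_nonneg hρ.le (sub_nonneg.2 hle)).trans_eq e.symm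

theorem abs_im_sub_le_of_tangent_eq_one (h : TangentFrame R a b γ T ρ k) (hab : a ≤ b)
    (hT : T a = 1) (hpos : ∀ t ∈ Ioo a b, 0 < (T t).re) (hR : (γ b).re - (γ a).re ≤ R) :
    |(γ b).im - (γ a).im| ≤ R - √(R ^ 2 - ((γ b).re - (γ a).re) ^ 2) := by
  refine abs_le'.2 ⟨h.im_sub_le_of_tangent_eq_one hab hT hpos hR, ?_⟩
  have := h.conj.im_sub_le_of_tangent_eq_one hab (by simp [hT]) (by simpa using hpos)
    (by simpa using hR)
  simp only [Complex.conj_im, Complex.conj_re] at this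
  linarith

theorem conj_tangent_mul_self (h : TangentFrame R a b γ T ρ k) {t : ℝ} (ht : t ∈ Icc a b) :
    (starRingEnd ℂ) (T t) * T t = 1 := by
  rw [mul_comm, Complex.mul_conj, Complex.normSq_eq_norm_sq, h.norm_tangent t ht]
  simp

theorem rotate_tangent (h : TangentFrame R a b γ T ρ k) {t : ℝ} (ht : t ∈ Icc a b) (c : ℂ) :
    TangentFrame R a b (fun s => (starRingEnd ℂ) (T t) * (γ s - c))
      (fun s => (starRingEnd ℂ) (T t) * T s) ρ k :=
  h.rotate (by simpa using h.norm_tangent t ht) c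

/-- The curve stays outside of the two circles of radius `R` that touch it at its start. -/
theorem abs_im_le_left (h : TangentFrame R a b γ T ρ k) (hab : a ≤ b)
    (hpos : ∀ t ∈ Ioo a b, 0 < ((starRingEnd ℂ) (T a) * T t).re)
    (hR : ((starRingEnd ℂ) (T a) * (γ b - γ a)).re ≤ R) :
    |((starRingEnd ℂ) (T a) * (γ b - γ a)).im| ≤
      R - √(R ^ 2 - ((starRingEnd ℂ) (T a) * (γ b - γ a)).re ^ 2) := by
  have ha := left_mem_Icc.2 hab
  simpa using (h.rotate_tangent ha (γ a)).abs_im_sub_le_of_tangent_eq_one hab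
    (h.conj_tangent_mul_self ha) hpos (by simpa using hR)

/-- The curve stays outside of the two circles of radius `R` that touch it at its end. -/
theorem abs_im_le_right (h : TangentFrame R a b γ T ρ k) (hab : a ≤ b)
    (hpos : ∀ t ∈ Ioo a b, 0 < ((starRingEnd ℂ) (T b) * T t).re)
    (hR : ((starRingEnd ℂ) (T b) * (γ b - γ a)).re ≤ R) :
    |((starRingEnd ℂ) (T b) * (γ b - γ a)).im| ≤
      R - √(R ^ 2 - ((starRingEnd ℂ) (T b) * (γ b - γ a)).re ^ 2) := by
  have e : (starRingEnd ℂ) (-T b) * (γ a - γ b) = (starRingEnd ℂ) (T b) * (γ b - γ a) := by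
    rw [map_neg]; ring
  have := h.reverse.abs_im_le_left (neg_le_neg hab)
  simp only [neg_neg, e] at this
  refine this (fun t ht => ?_) hR
  have := hpos (-t) ⟨by linarith [ht.2], by linarith [ht.1]⟩
  rwa [map_neg, neg_mul_neg]

/-! ### Acute tangents on arcs within distance `R` of their start -/

/-- At the first time the tangent is vertical, its imaginary part has changed by 1, so the curve has
advanced by at least `R` along the real axis and has left the disk. -/
theorem tangent_re_pos_of_tangent_eq_one (h : TangentFrame R a b γ T ρ k)
    (hT : T a = 1) (hball : ∀ t ∈ Ico a b, ‖γ t - γ a‖ < R) {t : ℝ} (ht : t ∈ Ico a b) :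
    0 < (T t).re := by
  by_contra hcon
  have hsub : Icc a t ⊆ Icc a b := Icc_subset_Icc_right ht.2.le
  have hcont : ContinuousOn (fun s => (T s).re) (Icc a t) :=
    (Complex.continuous_re.comp_continuousOn h.continuousOn_tangent).mono hsub
  have hcl : IsClosed (Icc a t ∩ (fun s => (T s).re) ⁻¹' Iic 0) :=
    hcont.preimage_isClosed_of_isClosed isClosed_Icc isClosed_Iic
  have hcpt := isCompact_Icc.of_isClosed_subset hcl inter_subset_left
  obtain ⟨c, ⟨hc, hc0⟩, hleast⟩ := hcpt.exists_isLeast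
    ⟨t, right_mem_Icc.2 ht.1, not_lt.1 hcon⟩
  have hlt : ∀ s ∈ Ico a c, 0 < (T s).re := by
    intro s hs
    by_contra hs0
    exact absurd (hleast ⟨⟨hs.1, hs.2.le.trans hc.2⟩, not_lt.1 hs0⟩) (not_le.2 hs.2)
  have hac : a < c := by
    rcases hc.1.eq_or_lt with e | e
    · rw [← e] at hc0
      simp [hT] at hc0
      linarith
    · exact e
  have hc1 : c ∈ Ico a b := ⟨hc.1, hc.2.trans_lt ht.2⟩
  have hge : 0 ≤ (T c).re := by
    have hw : ContinuousWithinAt (fun s => (T s).re) (Ico a c) c :=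
      (hcont c hc).mono fun s hs => ⟨hs.1, hs.2.le.trans hc.2⟩
    refine closure_minimal (s := Ioi 0) (fun _ hx => le_of_lt hx) isClosed_Ici
      (hw.mem_closure (t := Ioi 0) ?_ hlt)
    rw [closure_Ico hac.ne]
    exact right_mem_Icc.2 hac.le
  have hz : (T c).re = 0 := le_antisymm hc0 hge
  have him := (h.mono le_rfl hc1.2.le).abs_im_tangent_sub_le hc.1
    fun s hs => (hlt s ⟨hs.1.le, hs.2⟩).le
  have hsq := h.tangent_sq ⟨hc1.1, hc1.2.le⟩
  have h1 : |(T c).im| = 1 := by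
    rw [hz] at hsq
    rw [← abs_one, ← sq_eq_sq_iff_abs_eq_abs]
    linarith
  rw [hT, Complex.one_im, sub_zero, h1, mul_one, ← Complex.sub_re] at him
  linarith [Complex.re_le_norm (γ c - γ a), hball c hc1]

end TangentFrame

/-- The key identity is `(c₁c₂)² - (s₁s₂)² = 1 - s₁² - s₂²`. If `s₁s₂ < 0`, the right side is
positive because `(s₁ - s₂)² < 1`. Otherwise both summands are nonnegative, and if both vanished the
identity would again give a contradiction. -/
theorem inner_pos_of_abs_sub_lt_one {c₁ s₁ c₂ s₂ : ℝ} (h₁ : c₁ ^ 2 + s₁ ^ 2 = 1)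
    (h₂ : c₂ ^ 2 + s₂ ^ 2 = 1) (hc₁ : 0 ≤ c₁) (hc₂ : 0 ≤ c₂) (h : |s₁ - s₂| < 1) :
    0 < c₁ * c₂ + s₁ * s₂ := by
  have hsq : (s₁ - s₂) ^ 2 < 1 := (sq_lt_one_iff_abs_lt_one _).2 h
  rcases le_or_gt 0 (s₁ * s₂) with hs | hs
  · have hcc := mul_nonneg hc₁ hc₂
    refine lt_of_le_of_ne (by positivity) fun e => ?_
    have hc0 : c₁ * c₂ = 0 := by linarith
    have hs0 : s₁ * s₂ = 0 := by linarith
    have h3 : s₁ ^ 2 + s₂ ^ 2 < 1 := by nlinarith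
    have h4 : (c₁ * c₂) ^ 2 = (1 - s₁ ^ 2) * (1 - s₂ ^ 2) := by
      linear_combination c₂ ^ 2 * h₁ + (1 - s₁ ^ 2) * h₂
    rw [hc0] at h4
    nlinarith [mul_self_nonneg (s₁ * s₂)]
  · have h3 : s₁ ^ 2 + s₂ ^ 2 < 1 := by nlinarith
    have h4 : (-(s₁ * s₂)) ^ 2 < (c₁ * c₂) ^ 2 := by
      have e : (c₁ * c₂) ^ 2 = (1 - s₁ ^ 2) * (1 - s₂ ^ 2) := by
        linear_combination c₂ ^ 2 * h₁ + (1 - s₁ ^ 2) * h₂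
      rw [e]
      nlinarith
    have := (sq_lt_sq₀ (by linarith) (mul_nonneg hc₁ hc₂)).1 h4
    linarith

theorem conj_mul_conj_mul {u : ℂ} (hu : ‖u‖ = 1) (z w : ℂ) :
    (starRingEnd ℂ) (u * z) * (u * w) = (starRingEnd ℂ) z * w := by
  have : (starRingEnd ℂ) u * u = 1 := by
    rw [mul_comm, Complex.mul_conj, Complex.normSq_eq_norm_sq, hu]
    simp
  rw [map_mul]
  linear_combination ((starRingEnd ℂ) z * w) * this

/-- The tangents at any two points of the arc, except possibly its two ends, make an acute
angle. -/
def AcuteTangents (a b : ℝ) (T : ℝ → ℂ) : Prop :=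
  ∀ s ∈ Icc a b, ∀ r ∈ Icc a b, s ≤ r → (a < s ∨ r < b) → 0 < ((starRingEnd ℂ) (T s) * T r).re

theorem AcuteTangents.symm_of_mem_Ioo {a b : ℝ} {T : ℝ → ℂ} (h : AcuteTangents a b T) {s r : ℝ}
    (hs : s ∈ Icc a b) (hr : r ∈ Ioo a b) : 0 < ((starRingEnd ℂ) (T s) * T r).re := by
  have hr' := Ioo_subset_Icc_self hr
  rcases le_total s r with hsr | hsr
  · exact h s hs r hr' hsr (.inr hr.2)
  · have := h r hr' s hs hsr (.inl hr.1)
    rwa [← Complex.conj_re, map_mul, Complex.conj_conj, mul_comm] at this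

theorem AcuteTangents.rotate {a b : ℝ} {T : ℝ → ℂ} (h : AcuteTangents a b T) {u : ℂ}
    (hu : ‖u‖ = 1) : AcuteTangents a b fun t => u * T t := by
  intro s hs r hr hsr hor
  rw [conj_mul_conj_mul hu]
  exact h s hs r hr hsr hor

theorem AcuteTangents.conj {a b : ℝ} {T : ℝ → ℂ} (h : AcuteTangents a b T) :
    AcuteTangents a b fun t => (starRingEnd ℂ) (T t) := by
  intro s hs r hr hsr hor
  rw [← map_mul, Complex.conj_re]
  exact h s hs r hr hsr hor

namespace TangentFrame

variable {R a b : ℝ} {γ T : ℝ → ℂ} {ρ k : ℝ → ℝ}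

theorem acuteTangents_of_tangent_eq_one (h : TangentFrame R a b γ T ρ k)
    (hT : T a = 1) (hball : ∀ t ∈ Ico a b, ‖γ t - γ a‖ < R) : AcuteTangents a b T := by
  intro s hs r hr hsr hor
  have hRp := h.radius_pos
  rcases hsr.eq_or_lt with e | hlt
  · rw [e, h.conj_tangent_mul_self hr]
    exact one_pos
  have hab : a < b := hs.1.trans_lt (hlt.trans_le hr.2)
  have hpos : ∀ t ∈ Ico a b, 0 < (T t).re :=
    fun t ht => h.tangent_re_pos_of_tangent_eq_one hT hball ht
  have hnonneg : ∀ t ∈ Icc a b, 0 ≤ (T t).re := by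
    have hc := Complex.continuous_re.comp_continuousOn h.continuousOn_tangent
    rw [← closure_Ico hab.ne] at hc ⊢
    exact fun t ht => le_on_closure (fun r hr => (hpos r hr).le) continuousOn_const hc ht
  have hend : ‖γ b - γ a‖ ≤ R := by
    have hc : ContinuousOn (fun t => ‖γ t - γ a‖) (Icc a b) :=
      (h.continuousOn.sub continuousOn_const).norm
    rw [← closure_Ico hab.ne] at hc
    refine le_on_closure (fun r hr => (hball r hr).le) hc continuousOn_const ?_
    rw [closure_Ico hab.ne]
    exact right_mem_Icc.2 hab.le
  -- The abscissa increases strictly, so leaving out either end makes the advance strictly less than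
  -- `R`; this is why `AcuteTangents` exempts the pair of both ends.
  have hx : (γ r).re - (γ s).re < R := by
    have h1 : (γ r).re ≤ (γ b).re := by
      rcases hr.2.eq_or_lt with e | e
      · rw [e]
      · exact ((h.mono hr.1 le_rfl).re_lt_re e
          fun t ht => hpos t ⟨hr.1.trans ht.1.le, ht.2⟩).le
    have h2 : (γ a).re ≤ (γ s).re := by
      rcases hs.1.eq_or_lt with e | e
      · rw [e]
      · exact ((h.mono le_rfl hs.2).re_lt_re e fun t ht => hpos t ⟨ht.1.le, ht.2.trans_le hs.2⟩).le
    have h3 := (Complex.re_le_norm (γ b - γ a)).trans hend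
    rw [Complex.sub_re] at h3
    rcases hor with e | e
    · have := (h.mono le_rfl hs.2).re_lt_re e fun t ht => hpos t ⟨ht.1.le, ht.2.trans_le hs.2⟩
      linarith
    · have := (h.mono hr.1 le_rfl).re_lt_re e fun t ht => hpos t ⟨hr.1.trans ht.1.le, ht.2⟩
      linarith
  have him := (h.mono hs.1 hr.2).abs_im_tangent_sub_le hsr
    fun t ht => hnonneg t ⟨hs.1.trans ht.1.le, ht.2.le.trans hr.2⟩
  have h1 : |(T s).im - (T r).im| < 1 := by
    rw [abs_sub_comm]
    by_contra hcon
    nlinarith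
  have := inner_pos_of_abs_sub_lt_one (h.tangent_sq hs) (h.tangent_sq hr) (hnonneg s hs)
    (hnonneg r hr) h1
  rw [Complex.mul_re, Complex.conj_re, Complex.conj_im]
  linarith

theorem acuteTangents (h : TangentFrame R a b γ T ρ k) (hab : a ≤ b)
    (hball : ∀ t ∈ Ico a b, ‖γ t - γ a‖ < R) : AcuteTangents a b T := by
  have ha := left_mem_Icc.2 hab
  have hn : ‖(starRingEnd ℂ) (T a)‖ = 1 := by simpa using h.norm_tangent a ha
  have := (h.rotate_tangent ha 0).acuteTangents_of_tangent_eq_one (h.conj_tangent_mul_self ha) ?_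
  · intro s hs r hr hsr hor
    rw [← conj_mul_conj_mul hn]
    exact this s hs r hr hsr hor
  · intro t ht
    rw [← mul_sub, norm_mul, hn, one_mul]
    simpa using hball t ht

theorem projection_nonneg (h : TangentFrame R a b γ T ρ k) {u : ℂ} {c d : ℝ}
    (hc : a ≤ c) (hcd : c ≤ d) (hd : d ≤ b) (hu : ‖u‖ = 1)
    (hpos : ∀ t ∈ Ioo c d, 0 < ((starRingEnd ℂ) u * T t).re) :
    0 ≤ ((starRingEnd ℂ) u * (γ d - γ c)).re := by
  rcases hcd.eq_or_lt with e | e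
  · simp [e]
  · have := ((h.mono hc hd).rotate (u := (starRingEnd ℂ) u) (by simpa using hu) (γ c)).re_lt_re e
      hpos
    simpa using this.le

/-- Along an arc with acute tangents, the distance from the end of the arc decreases. -/
theorem norm_sub_right_le (h : TangentFrame R a b γ T ρ k) (hac : AcuteTangents a b T)
    {c : ℝ} (hc : c ∈ Icc a b) : ‖γ b - γ c‖ ≤ ‖γ b - γ a‖ := by
  have key := le_of_hasDerivAt_nonneg
    (f := fun t => -(((γ b).re - (γ t).re) ^ 2 + ((γ b).im - (γ t).im) ^ 2)) hc.1 ?_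
    (fun t ht => ((((h.hasDerivAt_re ⟨ht.1, ht.2.trans_le hc.2⟩).const_sub (γ b).re).pow 2).add
      (((h.hasDerivAt_im ⟨ht.1, ht.2.trans_le hc.2⟩).const_sub (γ b).im).pow 2)).neg) ?_
  · rw [← sq_le_sq₀ (norm_nonneg _) (norm_nonneg _), Complex.sq_norm, Complex.sq_norm,
      Complex.normSq_apply, Complex.normSq_apply]
    simp only [Complex.sub_re, Complex.sub_im]
    linarith
  · have h1 := h.continuousOn_re.mono (Icc_subset_Icc_right hc.2)
    have h2 := h.continuousOn_im.mono (Icc_subset_Icc_right hc.2)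
    fun_prop
  · intro t ht
    have htb : t ∈ Icc a b := ⟨ht.1.le, ht.2.le.trans hc.2⟩
    -- The derivative is `2 * ρ t` times the inner product of `T t` with `γ b - γ t`, and the latter
    -- accumulates positive inner products of tangents.
    have hp := h.projection_nonneg htb.1 htb.2 le_rfl (h.norm_tangent t htb)
      fun r hr => hac.symm_of_mem_Ioo htb ⟨ht.1.trans hr.1, hr.2⟩
    rw [Complex.mul_re, Complex.conj_re, Complex.conj_im, Complex.sub_re, Complex.sub_im] at hp
    have := mul_nonneg (h.speed_pos t htb).le hp
    norm_num
    nlinarith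

end TangentFrame

/-! ### Angles and height of an arc over its chord -/

/-- Lying outside the circles means `R² - x² ≤ (R - |y|)²`, that is `2R|y| ≤ x² + y² = l²`, so the
sine of the angle is at most `l / (2R)`. -/
theorem abs_arg_le_arcsin {z : ℂ} {l R : ℝ} (hl : 0 < l) (hlR : l ≤ R) (hz : ‖z‖ = l)
    (hre : 0 ≤ z.re) (him : |z.im| ≤ R - √(R ^ 2 - z.re ^ 2)) :
    |z.arg| ≤ Real.arcsin (l / (2 * R)) := by
  have hR : 0 < R := hl.trans_le hlR
  have hzR : z.re ≤ R := (Complex.re_le_norm z).trans (hz.trans_le hlR)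
  have hsq : z.re ^ 2 + z.im ^ 2 = l ^ 2 := by
    have := Complex.sq_norm z
    rw [hz, Complex.normSq_apply] at this
    linarith
  have h1 : √(R ^ 2 - z.re ^ 2) ≤ R - |z.im| := by linarith
  have h2 := Real.sqrt_le_left ((Real.sqrt_nonneg _).trans h1) |>.1 h1
  have h3 : |z.im| / l ≤ l / (2 * R) := by
    rw [div_le_div_iff₀ hl (by positivity)]
    nlinarith [sq_abs z.im]
  have h4 : |Real.arcsin (z.im / l)| = Real.arcsin (|z.im| / l) := by
    rcases le_total 0 z.im with h | h
    · rw [abs_of_nonneg h, abs_of_nonneg (Real.arcsin_nonneg.2 (div_nonneg h hl.le))]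
    · rw [abs_of_nonpos h, neg_div, Real.arcsin_neg,
        abs_of_nonpos (Real.arcsin_nonpos.2 (div_nonpos_of_nonpos_of_nonneg h hl.le))]
  rw [Complex.arg_of_re_nonneg hre, hz, h4]
  exact Real.monotone_arcsin h3

/-- `γ` leaves the open disk of radius `l` about `γ a` for the first time at `b`. -/
structure IsFirstExit (l : ℝ) (γ : ℝ → ℂ) (a b : ℝ) : Prop where
  lt : a < b
  norm_eq : ‖γ b - γ a‖ = l
  norm_lt : ∀ t ∈ Ico a b, ‖γ t - γ a‖ < l

namespace TangentFrame

variable {R a b l : ℝ} {γ T : ℝ → ℂ} {ρ k : ℝ → ℝ}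

theorem acuteTangents_of_isFirstExit (h : TangentFrame R a b γ T ρ k) (hf : IsFirstExit l γ a b)
    (hlR : l ≤ R) : AcuteTangents a b T :=
  h.acuteTangents hf.lt.le fun t ht => (hf.norm_lt t ht).trans_le hlR

theorem abs_arg_left_le (h : TangentFrame R a b γ T ρ k) (hf : IsFirstExit l γ a b)
    (hl : 0 < l) (hlR : l ≤ R) :
    |((starRingEnd ℂ) (T a) * (γ b - γ a)).arg| ≤ Real.arcsin (l / (2 * R)) := by
  have ha := left_mem_Icc.2 hf.lt.le
  have hpos : ∀ t ∈ Ioo a b, 0 < ((starRingEnd ℂ) (T a) * T t).re :=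
    fun t ht => (h.acuteTangents_of_isFirstExit hf hlR).symm_of_mem_Ioo ha ht
  have hn : ‖(starRingEnd ℂ) (T a) * (γ b - γ a)‖ = l := by
    rw [norm_mul, hf.norm_eq, RCLike.norm_conj, h.norm_tangent a ha, one_mul]
  exact abs_arg_le_arcsin hl hlR hn
    (h.projection_nonneg le_rfl hf.lt.le le_rfl (h.norm_tangent a ha) hpos)
    (h.abs_im_le_left hf.lt.le hpos ((Complex.re_le_norm _).trans (hn.trans_le hlR)))

theorem abs_arg_right_le (h : TangentFrame R a b γ T ρ k) (hf : IsFirstExit l γ a b)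
    (hl : 0 < l) (hlR : l ≤ R) :
    |((starRingEnd ℂ) (T b) * (γ b - γ a)).arg| ≤ Real.arcsin (l / (2 * R)) := by
  have hb := right_mem_Icc.2 hf.lt.le
  have hpos : ∀ t ∈ Ioo a b, 0 < ((starRingEnd ℂ) (T b) * T t).re :=
    fun t ht => (h.acuteTangents_of_isFirstExit hf hlR).symm_of_mem_Ioo hb ht
  have hn : ‖(starRingEnd ℂ) (T b) * (γ b - γ a)‖ = l := by
    rw [norm_mul, hf.norm_eq, RCLike.norm_conj, h.norm_tangent b hb, one_mul]
  exact abs_arg_le_arcsin hl hlR hn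
    (h.projection_nonneg le_rfl hf.lt.le le_rfl (h.norm_tangent b hb) hpos)
    (h.abs_im_le_right hf.lt.le hpos ((Complex.re_le_norm _).trans (hn.trans_le hlR)))

/-- The height of an arc with acute tangents over a horizontal chord of length `l` is at most the
height of an arc of a circle of radius `R` over such a chord. -/
theorem im_le_of_horizontal_chord (h : TangentFrame R a b γ T ρ k) (hab : a ≤ b)
    (hac : AcuteTangents a b T) (hl : 0 < l) (hlR : l ≤ R) (ha : γ a = 0) (hb : γ b = l) {t : ℝ}
    (ht : t ∈ Icc a b) : (γ t).im ≤ R - √(R ^ 2 - l ^ 2 / 4) := by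
  have hR := h.radius_pos
  obtain ⟨c, hc, hmax⟩ := isCompact_Icc.exists_isMaxOn ⟨a, left_mem_Icc.2 hab⟩ h.continuousOn_im
  refine (hmax ht).trans ?_
  have hd0 : 0 ≤ R - √(R ^ 2 - l ^ 2 / 4) :=
    sub_nonneg.2 (Real.sqrt_le_iff.2 ⟨hR.le, by nlinarith [sq_nonneg l]⟩)
  rcases hc.1.eq_or_lt with e | hac'
  · simpa [← e, ha] using hd0
  rcases hc.2.eq_or_lt with e | hcb
  · simpa [e, hb] using hd0
  have hco : c ∈ Ioo a b := ⟨hac', hcb⟩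
  have hpos : ∀ t ∈ Ioo a b, 0 < ((starRingEnd ℂ) (T c) * T t).re :=
    fun t ht => hac.symm_of_mem_Ioo hc ht
  have him : (T c).im = 0 := by
    have := (hmax.isLocalMax (Icc_mem_nhds hac' hcb)).hasDerivAt_eq_zero (h.hasDerivAt_im hco)
    exact (mul_eq_zero.1 this).resolve_left (h.speed_pos c hc).ne'
  -- The tangent at the highest point is `1` or `-1`; acuteness makes its product with the chord
  -- nonnegative, which excludes `-1`.
  have hTc : T c = 1 := by
    have hsq := h.tangent_sq hc
    have hp := h.projection_nonneg le_rfl hab le_rfl (h.norm_tangent c hc) hpos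
    rw [ha, hb, sub_zero, Complex.re_mul_ofReal, Complex.conj_re] at hp
    have hre0 : 0 ≤ (T c).re := nonneg_of_mul_nonneg_left hp hl
    rw [him] at hsq
    refine Complex.ext ?_ (by rw [him, Complex.one_im])
    rw [Complex.one_re]
    nlinarith
  simp only [hTc, map_one, one_mul] at hpos
  have hposl : ∀ t ∈ Ioo a c, 0 < ((starRingEnd ℂ) (T c) * T t).re :=
    fun t ht => by simpa [hTc] using hpos t ⟨ht.1, ht.2.trans hcb⟩
  have hposr : ∀ t ∈ Ioo c b, 0 < ((starRingEnd ℂ) (T c) * T t).re :=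
    fun t ht => by simpa [hTc] using hpos t ⟨hac'.trans ht.1, ht.2⟩
  have hx0 : 0 < (γ c).re := by
    simpa [ha] using (h.mono le_rfl hc.2).re_lt_re hac' fun t ht =>
      hpos t ⟨ht.1, ht.2.trans hcb⟩
  have hx1 : (γ c).re < l := by
    simpa [hb] using (h.mono hc.1 le_rfl).re_lt_re hcb fun t ht =>
      hpos t ⟨hac'.trans ht.1, ht.2⟩
  have hmono : ∀ x, 0 ≤ x → x ≤ l / 2 →
      R - √(R ^ 2 - x ^ 2) ≤ R - √(R ^ 2 - l ^ 2 / 4) := by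
    intro x hx hxl
    have : R ^ 2 - l ^ 2 / 4 ≤ R ^ 2 - x ^ 2 := by nlinarith
    linarith [Real.sqrt_le_sqrt this]
  -- The highest point is within `l / 2` horizontally of one end of the chord; compare with the
  -- circle touching the arc at that point, on the side of this end.
  rcases le_total (γ c).re (l / 2) with hx | hx
  · have := (h.mono le_rfl hc.2).abs_im_le_right hc.1 hposl
    simp only [hTc, ha, map_one, one_mul, sub_zero] at this
    exact ((le_abs_self _).trans (this (by linarith))).trans (hmono _ hx0.le hx)
  · have := (h.mono hc.1 le_rfl).abs_im_le_left hc.2 hposr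
    simp only [hTc, hb, map_one, one_mul, Complex.sub_re, Complex.sub_im, Complex.ofReal_re,
      Complex.ofReal_im, zero_sub, abs_neg] at this
    exact ((le_abs_self _).trans (this (by linarith))).trans
      (hmono _ (by linarith) (by linarith))

/-- Every point of the chord is within the height of a circular arc of the curve. -/
theorem exists_dist_le_of_mem_segment (h : TangentFrame R a b γ T ρ k) (hf : IsFirstExit l γ a b)
    (hl : 0 < l) (hlR : l ≤ R) {z : ℂ} (hz : z ∈ segment ℝ (γ a) (γ b)) :
    ∃ t ∈ Icc a b, dist z (γ t) ≤ R - √(R ^ 2 - l ^ 2 / 4) := by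
  have hab := hf.lt.le
  set u : ℂ := (starRingEnd ℂ) (γ b - γ a) / l with hu
  have hu1 : ‖u‖ = 1 := by
    rw [hu, norm_div, RCLike.norm_conj, hf.norm_eq, Complex.norm_real, Real.norm_of_nonneg hl.le,
      div_self hl.ne']
  have hF := h.rotate hu1 (γ a)
  have hac := (h.acuteTangents_of_isFirstExit hf hlR).rotate hu1
  have hFa : u * (γ a - γ a) = 0 := by simp
  have hFb : u * (γ b - γ a) = l := by
    have hl' : (l : ℂ) ≠ 0 := by exact_mod_cast hl.ne'
    rw [hu, div_mul_eq_mul_div, mul_comm, Complex.mul_conj, Complex.normSq_eq_norm_sq,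
      hf.norm_eq, div_eq_iff hl']
    push_cast
    ring
  rw [segment_eq_image'] at hz
  obtain ⟨x, hx, rfl⟩ := hz
  -- With the chord rotated to `[0, l]`, take a point of the arc directly above or below the given
  -- one.
  obtain ⟨t, ht, htx⟩ := intermediate_value_Icc hab hF.continuousOn_re (show x * l ∈ _ by
    rw [hFa, hFb, Complex.zero_re, Complex.ofReal_re]
    exact ⟨mul_nonneg hx.1 hl.le, by nlinarith [hx.2]⟩)
  refine ⟨t, ht, ?_⟩
  have hup := hF.im_le_of_horizontal_chord hab hac hl hlR hFa hFb ht
  have hlo := hF.conj.im_le_of_horizontal_chord hab hac.conj hl hlR (by rw [hFa, map_zero])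
    (by rw [hFb, Complex.conj_ofReal]) ht
  rw [Complex.conj_im] at hlo
  have e : u * (γ a + x • (γ b - γ a) - γ t) = -((u * (γ t - γ a)).im : ℂ) * Complex.I := by
    have h1 : u * (γ a + x • (γ b - γ a) - γ t) = x * (u * (γ b - γ a)) - u * (γ t - γ a) := by
      rw [Complex.real_smul]; ring
    rw [h1, hFb]
    refine Complex.ext ?_ ?_ <;> simp at htx ⊢ <;> linarith
  rw [dist_eq_norm, ← one_mul ‖_‖, ← hu1, ← norm_mul, e, norm_mul, norm_neg, Complex.norm_I,
    mul_one, Complex.norm_real, Real.norm_eq_abs]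
  exact abs_le'.2 ⟨hup, hlo⟩

/-! ### Existence of the first exits -/

/-- A curve that starts at `a` reaches distance `l` from its start not later than at `d` if it has
chord length `l` from some later time `c` to `d`. -/
theorem exists_isFirstExit (h : TangentFrame R a b γ T ρ k) (hl : 0 < l) (hlR : l ≤ R)
    {c d : ℝ} (hc : a ≤ c) (hcd : c ≤ d) (hd : d ≤ b) (hn : ‖γ d - γ c‖ = l) :
    ∃ t ≤ d, IsFirstExit l γ a t := by
  have hF := h.mono le_rfl hd
  have hex : ∃ t ∈ Icc a d, l ≤ ‖γ t - γ a‖ := by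
    -- Otherwise the tangents on `[a, d]` are acute and the distance to `γ d` decreases, so `l = ‖γ
    -- d - γ c‖ ≤ ‖γ d - γ a‖ < l`.
    by_contra! hcon
    have hac := hF.acuteTangents (hc.trans hcd)
      fun t ht => (hcon t (Ico_subset_Icc_self ht)).trans_le hlR
    have := hF.norm_sub_right_le hac ⟨hc, hcd⟩
    linarith [hcon d (right_mem_Icc.2 (hc.trans hcd))]
  have hcont : ContinuousOn (fun t => ‖γ t - γ a‖) (Icc a d) :=
    (hF.continuousOn.sub continuousOn_const).norm
  have hcpt := isCompact_Icc.of_isClosed_subset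
    (hcont.preimage_isClosed_of_isClosed isClosed_Icc (isClosed_Ici (a := l))) inter_subset_left
  obtain ⟨t, ⟨ht, htl⟩, hleast⟩ := hcpt.exists_isLeast hex
  have hlt : ∀ s ∈ Ico a t, ‖γ s - γ a‖ < l := by
    intro s hs
    by_contra hs0
    exact absurd (hleast ⟨⟨hs.1, hs.2.le.trans ht.2⟩, not_lt.1 hs0⟩) (not_le.2 hs.2)
  have hat : a < t := by
    rcases ht.1.eq_or_lt with e | e
    · rw [mem_preimage, ← e, sub_self, norm_zero] at htl
      exact absurd hl (not_lt.2 htl)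
    · exact e
  refine ⟨t, ht.2, hat, le_antisymm ?_ htl, hlt⟩
  have hc' := hcont.mono (Icc_subset_Icc_right ht.2)
  rw [← closure_Ico hat.ne] at hc'
  refine le_on_closure (fun s hs => (hlt s hs).le) hc' continuousOn_const ?_
  rw [closure_Ico hat.ne]
  exact right_mem_Icc.2 hat.le

/-- If `γ` visits the vertices of an equilateral polygon in order, then so it does for a polygon
that starts at an earlier point and whose vertices are consecutive first exits. -/
theorem exists_isFirstExit_sequence (h : TangentFrame R a b γ T ρ k) (hl : 0 < l) (hlR : l ≤ R)
    {t₀ : ℝ} (ht₀ : a ≤ t₀) (V : ℕ → ℝ) (hV₀ : t₀ ≤ V 0) (n : ℕ)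
    (hV : ∀ i < n, V i ≤ V (i + 1)) (hVb : ∀ i ≤ n, V i ≤ b)
    (hVl : ∀ i < n, ‖γ (V (i + 1)) - γ (V i)‖ = l) :
    ∃ t : ℕ → ℝ, t 0 = t₀ ∧ (∀ i ≤ n, a ≤ t i ∧ t i ≤ V i) ∧
      ∀ i < n, IsFirstExit l γ (t i) (t (i + 1)) := by
  induction n with
  | zero =>
    refine ⟨fun _ => t₀, rfl, fun i hi => ?_, fun i hi => absurd hi (Nat.not_lt_zero i)⟩
    rw [Nat.le_zero.1 hi]
    exact ⟨ht₀, hV₀⟩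
  | succ n ih =>
    obtain ⟨t, h0, hb, hf⟩ := ih (fun i hi => hV i (by omega)) (fun i hi => hVb i (by omega))
      (fun i hi => hVl i (by omega))
    -- The bound `t n ≤ V n` makes the chord from `V n` to `V (n + 1)` a later chord, which forces
    -- the next exit by time `V (n + 1)`.
    obtain ⟨hn1, hn2⟩ := hb n le_rfl
    obtain ⟨t', ht', hf'⟩ := (h.mono hn1 le_rfl).exists_isFirstExit hl hlR hn2 (hV n (by omega))
      (hVb (n + 1) le_rfl) (hVl n (by omega))
    refine ⟨fun i => if i ≤ n then t i else t', by simpa using h0, fun i hi => ?_, fun i hi => ?_⟩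
    · rcases Nat.le_or_eq_of_le_succ hi with e | e
      · simpa [e] using hb i e
      · rw [e]
        simpa using ⟨hn1.trans hf'.lt.le, ht'⟩
    · rcases Nat.lt_succ_iff_lt_or_eq.1 hi with e | e
      · have : i + 1 ≤ n := e
        simpa [e.le, this] using hf i e
      · simpa [e] using hf'

end TangentFrame

/-! ### Joint angles -/

theorem abs_arg_mul_le {z w : ℂ} {φ ψ : ℝ} (hz0 : z ≠ 0) (hw0 : w ≠ 0) (hz : |z.arg| ≤ φ)
    (hw : |w.arg| ≤ ψ) (h : φ + ψ < Real.pi) : |(z * w).arg| ≤ φ + ψ := by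
  have h1 := abs_le.1 hz
  have h2 := abs_le.1 hw
  rw [Complex.arg_mul hz0 hw0 ⟨by linarith, by linarith⟩]
  exact (abs_add_le _ _).trans (add_le_add hz hw)

/-- Angles add through the common direction `u`; a total below `π` rules out wrapping around. -/
theorem abs_arg_conj_mul_le {u z w : ℂ} {φ : ℝ} (hu : ‖u‖ = 1) (hz0 : z ≠ 0) (hw0 : w ≠ 0)
    (hz : |((starRingEnd ℂ) u * z).arg| ≤ φ) (hw : |((starRingEnd ℂ) u * w).arg| ≤ φ)
    (h : φ + φ < Real.pi) : |((starRingEnd ℂ) z * w).arg| ≤ φ + φ := by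
  have hu0 : (starRingEnd ℂ) u ≠ 0 := by
    rw [map_ne_zero, ← norm_ne_zero_iff, hu]
    exact one_ne_zero
  rw [← conj_mul_conj_mul (u := (starRingEnd ℂ) u) (by simpa using hu) z w]
  refine abs_arg_mul_le ((map_ne_zero _).2 (mul_ne_zero hu0 hz0)) (mul_ne_zero hu0 hw0) ?_ hw h
  rw [Complex.arg_conj]
  split_ifs with hπ
  · rwa [← hπ]
  · rwa [abs_neg]

/-- For `N ≥ 2`, `sin θ / N ≤ sin (θ/2) cos (θ/2) ≤ sin (θ/2)`. -/
theorem two_mul_arcsin_le {N : ℕ} (hN : 2 ≤ N) {θ : ℝ} (h0 : 0 < θ) (hπ : θ < Real.pi) :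
    Real.arcsin (Real.sin θ / N) + Real.arcsin (Real.sin θ / N) ≤ θ := by
  have hN' : (2 : ℝ) ≤ N := by exact_mod_cast hN
  have hs := Real.sin_pos_of_pos_of_lt_pi (x := θ / 2) (by linarith) (by linarith)
  have hle : Real.sin θ / N ≤ Real.sin (θ / 2) := by
    rw [div_le_iff₀ (by linarith)]
    have e : Real.sin θ = 2 * Real.sin (θ / 2) * Real.cos (θ / 2) := by
      rw [← Real.sin_two_mul]; ring_nf
    rw [e]
    nlinarith [Real.cos_le_one (θ / 2)]
  have := Real.monotone_arcsin hle
  rw [Real.arcsin_sin (by linarith) (by linarith)] at this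
  linarith

/-- The joint angles of the polygon with vertices `p` relative to the rest direction `u`. -/
noncomputable def turningAngle (u : ℂ) (p : ℕ → ℂ) : ℕ → ℝ
  | 0 => ((starRingEnd ℂ) u * (p 1 - p 0)).arg
  | j + 1 => ((starRingEnd ℂ) (p (j + 1) - p j) * (p (j + 2) - p (j + 1))).arg

/-- Used with `r = 1` for the unit rest direction and with `r = l` for a preceding edge. -/
theorem exp_arg_conj_mul {z w : ℂ} {r : ℝ} (hr : 0 < r) (hz : ‖z‖ = r) {l : ℝ}
    (hw : ‖w‖ = l) :
    (l : ℂ) * z * Complex.exp (((starRingEnd ℂ) z * w).arg * Complex.I) = r * w := by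
  have h := Complex.norm_mul_exp_arg_mul_I ((starRingEnd ℂ) z * w)
  rw [norm_mul, RCLike.norm_conj, hz, hw] at h
  have hzz : z * (starRingEnd ℂ) z = (r : ℂ) ^ 2 := by
    rw [Complex.mul_conj, Complex.normSq_eq_norm_sq, hz]
    push_cast
    ring
  have hr' : (r : ℂ) ≠ 0 := by exact_mod_cast hr.ne'
  refine mul_left_cancel₀ hr' ?_
  push_cast at h
  linear_combination z * h + w * hzz

theorem linkCenter_succ (l : ℝ) (p w : ℂ) (θ : ℕ → ℝ) (i : ℕ) :
    linkCenter l p w θ (i + 1) = linkCenter l p w θ i + (l : ℂ) * (w / (‖w‖ : ℂ)) *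
      Complex.exp (((∑ k ∈ Finset.range (i + 1), θ k : ℝ) : ℂ) * Complex.I) := by
  rw [linkCenter, linkCenter, Finset.sum_range_succ _ i]
  ring

theorem norm_unit {w : ℂ} (hw : w ≠ 0) : ‖w / (‖w‖ : ℂ)‖ = 1 := by
  rw [norm_div, Complex.norm_real, norm_norm, div_self (norm_ne_zero_iff.2 hw)]

theorem norm_linkCenter_succ_sub {l : ℝ} (hl : 0 < l) (p : ℂ) {w : ℂ} (hw : w ≠ 0) (θ : ℕ → ℝ)
    (i : ℕ) : ‖linkCenter l p w θ (i + 1) - linkCenter l p w θ i‖ = l := by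
  rw [linkCenter_succ, add_sub_cancel_left, norm_mul, norm_mul, norm_unit hw,
    Complex.norm_exp_ofReal_mul_I, Complex.norm_real, Real.norm_of_nonneg hl.le, mul_one, mul_one]

theorem linkCenter_turningAngle {N : ℕ} {l : ℝ} (hl : 0 < l) {w : ℂ} (hw : w ≠ 0) {p : ℕ → ℂ}
    (hp : ∀ i < N, ‖p (i + 1) - p i‖ = l) {i : ℕ} (hi : i ≤ N) :
    linkCenter l (p 0) w (turningAngle (w / (‖w‖ : ℂ)) p) i = p i := by
  set u := w / (‖w‖ : ℂ) with hu
  have hu1 : ‖u‖ = 1 := norm_unit hw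
  -- The accumulated rotation turns the rest direction into that of edge `j`, each factor turning
  -- one edge into the next.
  have hstep : ∀ j < N, (l : ℂ) * u * Complex.exp
      (((∑ k ∈ Finset.range (j + 1), turningAngle u p k : ℝ) : ℂ) * Complex.I)
        = p (j + 1) - p j := by
    intro j
    induction j with
    | zero =>
      intro hj
      have := exp_arg_conj_mul one_pos hu1 (hp 0 hj)
      simpa [turningAngle] using this
    | succ j ih =>
      intro hj
      have h1 := ih (by omega)
      have h2 := exp_arg_conj_mul hl (hp j (by omega)) (hp (j + 1) hj)
      have hl' : (l : ℂ) ≠ 0 := by exact_mod_cast hl.ne'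
      rw [Finset.sum_range_succ, Complex.ofReal_add, add_mul, Complex.exp_add, ← mul_assoc, h1]
      refine mul_left_cancel₀ hl' ?_
      rw [← mul_assoc]
      exact h2
  induction i with
  | zero => simp [linkCenter]
  | succ i ih => rw [linkCenter_succ, ih (by omega), ← hu, hstep i (by omega)]; ring

/-! ### The tangent frame of a regular path -/

theorem minRadius_mul_maxCurvature {N : ℕ} (hN : 0 < N) {l θbar : ℝ} (hl : 0 < l)
    (hsin : 0 < Real.sin θbar) : minRadius N l θbar * maxCurvature N l θbar = 1 := by
  have : (0 : ℝ) < N := by exact_mod_cast hN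
  rw [minRadius, maxCurvature]
  field_simp

theorem minRadius_pos {N : ℕ} (hN : 0 < N) {l θbar : ℝ} (hl : 0 < l)
    (hsin : 0 < Real.sin θbar) : 0 < minRadius N l θbar := by
  have : (0 : ℝ) < N := by exact_mod_cast hN
  rw [minRadius]
  positivity

theorem le_minRadius {N : ℕ} (hN : 2 ≤ N) {l θbar : ℝ} (hl : 0 < l)
    (hsin : 0 < Real.sin θbar) : l ≤ minRadius N l θbar := by
  have : (2 : ℝ) ≤ N := by exact_mod_cast hN
  rw [minRadius, le_div_iff₀ (by positivity)]
  nlinarith [Real.sin_le_one θbar]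

theorem div_two_mul_minRadius {N : ℕ} (hN : 0 < N) {l θbar : ℝ} (hl : 0 < l)
    (hsin : 0 < Real.sin θbar) : l / (2 * minRadius N l θbar) = Real.sin θbar / N := by
  have : (0 : ℝ) < N := by exact_mod_cast hN
  rw [minRadius]
  field_simp

/-- Only the component of `A` orthogonal to `V` turns the direction, which yields the determinant in
the curvature. -/
theorem hasDerivWithinAt_unit {V : ℝ → ℂ} {A : ℂ} {s : Set ℝ} {t : ℝ}
    (h : HasDerivWithinAt V A s t) (h0 : V t ≠ 0) :
    HasDerivWithinAt (fun r => V r / (‖V r‖ : ℂ))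
      ((((V t).re * A.im - (V t).im * A.re) / ‖V t‖ ^ 3 : ℝ) * (‖V t‖ : ℝ) * Complex.I *
        (V t / (‖V t‖ : ℂ))) s t := by
  have hn : ‖V t‖ ≠ 0 := norm_ne_zero_iff.2 h0
  have hn' : (‖V t‖ : ℂ) ≠ 0 := by exact_mod_cast hn
  have hsq : HasDerivWithinAt (fun r => ‖V r‖)
      (((V t).re * A.re + (V t).im * A.im) / ‖V t‖) s t := by
    have hre := Complex.reCLM.hasFDerivAt.comp_hasDerivWithinAt t h
    have him := Complex.imCLM.hasFDerivAt.comp_hasDerivWithinAt t h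
    have h2 := ((hre.pow 2).add (him.pow 2)).sqrt (by
      have := Complex.sq_norm (V t)
      rw [Complex.normSq_apply] at this
      have h3 : 0 < ‖V t‖ ^ 2 := by positivity
      simp
      nlinarith)
    have e : ∀ r, √((V r).re ^ 2 + (V r).im ^ 2) = ‖V r‖ := by
      intro r
      rw [Complex.norm_eq_sqrt_sq_add_sq]
    refine (h2.congr_deriv ?_).congr (fun r _ => (e r).symm) (e t).symm
    simp [e]
    field_simp
  refine (h.div hsq.ofReal_comp hn').congr_deriv ?_
  have hns : (‖V t‖ : ℂ) ^ 2 = ((V t).re ^ 2 + (V t).im ^ 2 : ℝ) := by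
    rw [← Complex.ofReal_pow, Complex.sq_norm, Complex.normSq_apply]
    push_cast
    ring
  push_cast at hns ⊢
  field_simp
  rw [hns]
  generalize V t = z
  refine Complex.ext ?_ ?_ <;> simp [sq] <;> ring

theorem velocity_hasDerivWithinAt {τ : ℝ → ℂ} (h : ContDiffOn ℝ 2 τ (Icc 0 1)) {t : ℝ}
    (ht : t ∈ Icc (0 : ℝ) 1) : HasDerivWithinAt τ (velocity τ t) (Icc 0 1) t :=
  (h.differentiableOn two_ne_zero t ht).hasDerivWithinAt

theorem tangentFrame_of_curvature_le {τ : ℝ → ℂ} (h : ContDiffOn ℝ 2 τ (Icc 0 1))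
    (hreg : ∀ s ∈ Icc (0 : ℝ) 1, velocity τ s ≠ 0) {R κ : ℝ} (hR : 0 < R) (hRκ : R * κ = 1)
    (hκ : ∀ s ∈ Icc (0 : ℝ) 1, curvature τ s ≤ κ) :
    TangentFrame R 0 1 τ (fun t => velocity τ t / (‖velocity τ t‖ : ℂ)) (fun t => ‖velocity τ t‖)
      (fun t => ((velocity τ t).re * (acceleration τ t).im -
        (velocity τ t).im * (acceleration τ t).re) / ‖velocity τ t‖ ^ 3) where
  radius_pos := hR
  hasDeriv t ht := by
    refine (velocity_hasDerivWithinAt h ht).congr_deriv ?_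
    have : (‖velocity τ t‖ : ℂ) ≠ 0 := by exact_mod_cast norm_ne_zero_iff.2 (hreg t ht)
    field_simp
  hasDeriv_tangent t ht := by
    have hv : ContDiffOn ℝ 1 (velocity τ) (Icc 0 1) :=
      h.derivWithin (uniqueDiffOn_Icc zero_lt_one) (by norm_num)
    exact hasDerivWithinAt_unit (hv.differentiableOn one_ne_zero t ht).hasDerivWithinAt (hreg t ht)
  norm_tangent t ht := norm_unit (hreg t ht)
  speed_pos t ht := norm_pos_iff.2 (hreg t ht)
  curvature_le t ht := by
    rw [abs_div, abs_of_nonneg (pow_nonneg (norm_nonneg _) 3), ← hRκ]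
    exact mul_le_mul_of_nonneg_left (hκ t ht) hR.le

/-! ### Concatenated paths -/

theorem concatPath_mul_left {b : ℝ} (hb : 0 < b) (τI τκ : ℝ → ℂ) {u : ℝ} (hu : u ≤ 1) :
    concatPath b τI τκ (b * u) = τI u := by
  rw [concatPath, if_pos (by nlinarith), mul_div_cancel_left₀ _ hb.ne']

theorem concatPath_right {b : ℝ} (hb : b ∈ Ioo (0 : ℝ) 1) {τI τκ : ℝ → ℂ} (h : τI 1 = τκ 0)
    {s : ℝ} (hs : 0 ≤ s) : concatPath b τI τκ (b + (1 - b) * s) = τκ s := by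
  have hb1 : 0 < 1 - b := by linarith [hb.2]
  rcases hs.eq_or_lt with e | e
  -- At the junction the concatenation takes its value from `τI`, so the joining condition is
  -- needed.
  · rw [← e, mul_zero, add_zero, ← h]
    simpa using concatPath_mul_left hb.1 τI τκ le_rfl
  · rw [concatPath, if_neg (by nlinarith), add_sub_cancel_left, mul_div_cancel_left₀ _ hb1.ne']

/-- The factor is positive, so headings agree, and `τκ` inherits regularity from the concatenation.
-/
theorem velocity_eq_of_concatPath {b : ℝ} (hb : b ∈ Ioo (0 : ℝ) 1) {τI τκ : ℝ → ℂ}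
    (h : τI 1 = τκ 0) (hd : ContDiffOn ℝ 2 (concatPath b τI τκ) (Icc 0 1)) {s : ℝ}
    (hs : s ∈ Icc (0 : ℝ) 1) :
    velocity τκ s = ((1 - b : ℝ) : ℂ) * velocity (concatPath b τI τκ) (b + (1 - b) * s) := by
  have hb1 : 0 < 1 - b := by linarith [hb.2]
  have hm : MapsTo (fun s => b + (1 - b) * s) (Icc (0 : ℝ) 1) (Icc 0 1) := fun r hr =>
    ⟨by nlinarith [hb.1, hr.1], by nlinarith [hr.2]⟩
  have ha : HasDerivWithinAt (fun s => b + (1 - b) * s) (1 - b) (Icc 0 1) s := by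
    simpa using ((hasDerivAt_id s).const_mul (1 - b)).const_add b |>.hasDerivWithinAt
  have := ((velocity_hasDerivWithinAt hd (hm hs)).scomp s ha hm).congr
    (fun r hr => (concatPath_right hb h hr.1).symm) (concatPath_right hb h hs.1).symm
  rw [velocity, this.derivWithin (uniqueDiffOn_Icc zero_lt_one s hs), Complex.real_smul]

/-! ### Joint limits and volume of the inscribed chain -/

/-- At an inner vertex the tangent splits the joint angle into the angles with the incoming and the
outgoing chord; at the root only the latter occurs. -/
theorem withinJointLimits_turningAngle {R a b l : ℝ} {γ T : ℝ → ℂ} {ρ k : ℝ → ℝ}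
    (h : TangentFrame R a b γ T ρ k) (hl : 0 < l) (hlR : l ≤ R) {N : ℕ} {θbar : ℝ}
    (hθ : Real.arcsin (l / (2 * R)) + Real.arcsin (l / (2 * R)) ≤ θbar) (hπ : θbar < Real.pi)
    {t : ℕ → ℝ} (ht : ∀ i ≤ N, t i ∈ Icc a b)
    (hf : ∀ i < N, IsFirstExit l γ (t i) (t (i + 1))) :
    WithinJointLimits N θbar (turningAngle (T (t 0)) fun i => γ (t i)) := by
  have h0 : 0 ≤ Real.arcsin (l / (2 * R)) :=
    Real.arcsin_nonneg.2 (div_nonneg hl.le (by linarith))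
  have hF : ∀ i < N, TangentFrame R (t i) (t (i + 1)) γ T ρ k :=
    fun i hi => h.mono (ht i hi.le).1 (ht (i + 1) hi).2
  have hne : ∀ i < N, γ (t (i + 1)) - γ (t i) ≠ 0 := by
    intro i hi e
    have := (hf i hi).norm_eq
    rw [e, norm_zero] at this
    exact hl.ne this
  intro i hi
  refine abs_le.1 ?_
  rcases i with _ | i
  · have := (hF 0 hi).abs_arg_left_le (hf 0 hi) hl hlR
    exact this.trans (by linarith)
  · have hi' : i < N := by omega
    exact (abs_arg_conj_mul_le (h.norm_tangent _ (ht (i + 1) hi.le)) (hne i hi') (hne (i + 1) hi)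
      ((hF i hi').abs_arg_right_le (hf i hi') hl hlR)
      ((hF (i + 1) hi).abs_arg_left_le (hf (i + 1) hi) hl hlR) (hθ.trans_lt hπ)).trans hθ

theorem mem_add_closedBall_of_dist_le {S : Set ℂ} {x y : ℂ} {r : ℝ} (hy : y ∈ S)
    (h : dist x y ≤ r) : x ∈ S + Metric.closedBall (0 : ℂ) r :=
  ⟨y, hy, x - y, by rwa [mem_closedBall_zero_iff, ← dist_eq_norm], add_sub_cancel y x⟩

theorem chainVolume_subset {N : ℕ} {l : ℝ} {δ : ℕ → ℝ} {p w : ℂ} {θ : ℕ → ℝ} {S : Set ℂ} {r : ℝ}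
    (hδ : ∀ i ≤ N, δ i ≤ r) (hS : ∀ i ≤ N, linkCenter l p w θ i ∈ S)
    (hseg : ∀ i < N, ∀ x ∈ segment ℝ (linkCenter l p w θ i) (linkCenter l p w θ (i + 1)),
      ∃ y ∈ S, dist x y ≤ r) :
    chainVolume N l δ p w θ ⊆ S + Metric.closedBall (0 : ℂ) r := by
  rintro x (hx | hx)
  · obtain ⟨i, hi, hx⟩ := mem_iUnion₂.1 hx
    exact mem_add_closedBall_of_dist_le (hS i hi) ((Metric.mem_closedBall.1 hx).trans (hδ i hi))
  · obtain ⟨i, hi, hx⟩ := mem_iUnion₂.1 hx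
    obtain ⟨y, hy, hxy⟩ := hseg i hi x hx
    exact mem_add_closedBall_of_dist_le hy hxy

theorem VisitsLinks.exists_times {N : ℕ} {c : ℕ → ℂ} {τI : ℝ → ℂ} (h : VisitsLinks N c τI) :
    ∃ u : ℕ → ℝ, u 0 = 1 ∧ (∀ i < N, u (i + 1) ≤ u i) ∧ (∀ i ≤ N, u i ∈ Icc (0 : ℝ) 1) ∧
      ∀ i ≤ N, τI (u i) = c i := by
  obtain ⟨u, h0, hN, hanti, hu⟩ := h
  refine ⟨u, h0, hanti, fun i hi => ⟨?_, ?_⟩, hu⟩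
  · rw [← hN]
    exact Nat.decreasingInduction' (P := fun j => u N ≤ u j)
      (fun j hj _ ih => ih.trans (hanti j hj)) hi le_rfl
  · induction i with
    | zero => rw [h0]
    | succ i ih => exact (hanti i hi).trans (ih (by omega))

end SerialChain

theorem mainTheorem4
    (N : ℕ) (hN : 1 < N) (l θbar : ℝ) (δ : ℕ → ℝ)
    (hθbar_pos : 0 < θbar) (hθbar_lt : θbar < Real.pi)
    (hδ_pos : ∀ i ≤ N, 0 < δ i)
    (h_disjoint : ∀ i < N, δ i + δ (i + 1) < l)
    (hδ_le : ∀ i ≤ N, δ i ≤ δ 0)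
    (h_dev : SerialChain.maxDeviation N l θbar ≤ δ 0)
    -- the root path `τκ`, the initial path `τI`, and their concatenation
    (τI τκ : ℝ → ℂ) (b : ℝ) (hb : b ∈ Set.Ioo (0 : ℝ) 1)
    (h_join : τI 1 = τκ 0) (v : ℂ)
    (h_path : SerialChain.concatPath b τI τκ ∈ SerialChain.pathSpace N l θbar (τI 0) v)
    -- the start configuration, along whose links `τI` runs from `L_N` to `L_0`
    (θstart : ℕ → ℝ) (h_start : SerialChain.WithinJointLimits N θbar θstart)
    (h_visits : SerialChain.VisitsLinks N
      (SerialChain.linkCenter l (τκ 0) (-SerialChain.velocity τκ 0) θstart) τI) :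
    ∀ s ∈ Set.Icc (0 : ℝ) 1, ∃ θ : ℕ → ℝ,
      SerialChain.WithinJointLimits N θbar θ ∧
      SerialChain.chainVolume N l δ (τκ s) (-SerialChain.velocity τκ s) θ ⊆
        SerialChain.concatPath b τI τκ '' Set.Icc 0 1 + Metric.closedBall (0 : ℂ) (δ 0) := by
  open SerialChain Set in
  intro s hs
  obtain ⟨hC2, hreg, -, -, -, hcurv⟩ := h_path
  set τ := concatPath b τI τκ with hτ
  have hN0 : 0 < N := by omega
  have hl : 0 < l := by
    linarith [hδ_pos 0 hN0.le, hδ_pos 1 hN.le, h_disjoint 0 hN0]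
  have hb1 : 0 < 1 - b := by linarith [hb.2]
  have hsin := Real.sin_pos_of_pos_of_lt_pi hθbar_pos hθbar_lt
  have hlR : l ≤ minRadius N l θbar := le_minRadius hN hl hsin
  have hF := (tangentFrame_of_curvature_le hC2 hreg (minRadius_pos hN0 hl hsin)
    (minRadius_mul_maxCurvature hN0 hl hsin) hcurv).reverse
  have htime : ∀ r ∈ Icc (0 : ℝ) 1, b + (1 - b) * r ∈ Icc (0 : ℝ) 1 := fun r hr =>
    ⟨by nlinarith [hb.1, hr.1], by nlinarith [hr.2]⟩
  have hvel : ∀ r ∈ Icc (0 : ℝ) 1, velocity τκ r ≠ 0 := by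
    intro r hr
    rw [velocity_eq_of_concatPath hb h_join hC2 hr]
    exact mul_ne_zero (by exact_mod_cast hb1.ne') (hreg _ (htime r hr))
  obtain ⟨u, hu0, hanti, hu01, hu⟩ := h_visits.exists_times
  have hτu : ∀ i ≤ N, τ (b * u i) = linkCenter l (τκ 0) (-velocity τκ 0) θstart i :=
    fun i hi => by rw [hτ, concatPath_mul_left hb.1 τI τκ (hu01 i hi).2, hu i hi]
  -- In reversed time the root is at `-(b + (1 - b) * s)`, and the start configuration has its
  -- vertices at the times `-(b * u i)`, beginning with `-b`.
  obtain ⟨t, ht0, htb, hexit⟩ := hF.exists_isFirstExit_sequence hl hlR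
    (t₀ := -(b + (1 - b) * s)) (by linarith [(htime s hs).2]) (fun i => -(b * u i))
    (by rw [hu0]; nlinarith [hs.1]) N
    (fun i hi => by nlinarith [hanti i hi, hb.1])
    (fun i hi => by nlinarith [(hu01 i hi).1, hb.1])
    (fun i hi => by
      simp only [neg_neg]
      rw [hτu i hi.le, hτu (i + 1) hi]
      exact norm_linkCenter_succ_sub hl _ (neg_ne_zero.2 (hvel 0 ⟨le_rfl, zero_le_one⟩)) _ _)
  have htmem : ∀ i ≤ N, t i ∈ Icc (-1 : ℝ) (-0) := fun i hi =>
    ⟨(htb i hi).1, (htb i hi).2.trans (by nlinarith [(hu01 i hi).1, hb.1])⟩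
  set p : ℕ → ℂ := fun i => τ (-t i) with hp
  have hp0 : p 0 = τκ s := by
    simp only [hp, ht0, neg_neg]
    exact concatPath_right hb h_join hs.1
  set w := -velocity τκ s with hw
  have hw0 : w ≠ 0 := neg_ne_zero.2 (hvel s hs)
  -- The rest direction is the unit tangent of the reversed path at the root.
  have hdir : w / (‖w‖ : ℂ) = -(velocity τ (-t 0) / (‖velocity τ (-t 0)‖ : ℂ)) := by
    have hc : ((1 - b : ℝ) : ℂ) ≠ 0 := by exact_mod_cast hb1.ne'
    rw [hw, ht0, neg_neg, velocity_eq_of_concatPath hb h_join hC2 hs, norm_neg, norm_mul,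
      Complex.norm_real, Real.norm_of_nonneg hb1.le, neg_div, Complex.ofReal_mul,
      mul_div_mul_left _ _ hc]
  have hθ := withinJointLimits_turningAngle hF hl hlR
    (by rw [div_two_mul_minRadius hN0 hl hsin]; exact two_mul_arcsin_le hN hθbar_pos hθbar_lt)
    hθbar_lt htmem hexit
  have hcenter : ∀ i ≤ N, linkCenter l (τκ s) w (turningAngle (w / (‖w‖ : ℂ)) p) i = p i := by
    intro i hi
    rw [← hp0]
    exact linkCenter_turningAngle hl hw0 (fun j hj => (hexit j hj).norm_eq) hi
  refine ⟨turningAngle (w / (‖w‖ : ℂ)) p, by rw [hdir]; exact hθ,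
    chainVolume_subset hδ_le (fun i hi => ?_) fun i hi x hx => ?_⟩
  · rw [hcenter i hi]
    exact ⟨-t i, ⟨by linarith [(htmem i hi).2], by linarith [(htmem i hi).1]⟩, rfl⟩
  · rw [hcenter i hi.le, hcenter (i + 1) hi] at hx
    obtain ⟨r, hr, hd⟩ := (hF.mono (htmem i hi.le).1
      (htmem (i + 1) hi).2).exists_dist_le_of_mem_segment (hexit i hi) hl hlR hx
    refine ⟨τ (-r), ⟨-r, ⟨?_, ?_⟩, rfl⟩, hd.trans h_dev⟩
    · linarith [hr.2, (htmem (i + 1) hi).2]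
    · linarith [hr.1, (htmem i hi.le).1]
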